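/- Let $n\ge 1$, let $\Omega\subset\mathbb R^n$ be a bounded convex domain (open set) with $0\in\partial\Omega$, let $0<\lambda<\infty$, and let $\varphi\in C(\partial\Omega)$ satisfy $\varphi\ge 0$ on $\partial\Omega$. Let $u\in C(\overline\Omega)$ be a nonnegative generalized (Alexandrov) solution of $$\det\nabla^2u\ \ge\ \lambda\quad\text{in }\Omega,\qquad u=\varphi\quad\text{on }\partial\Omega,$$ that is, $u$ is locally convex in $\Omega$ and $|\partial u(E)|\ge\lambda|E|$ for every Borel set $E\subset\Omega$, where $|\cdot|$ is Lebesgue measure, $\partial u(E)=\bigcup_{x\in E}\partial u(x)$ and $\partial u(x)=\{p\in\mathbb R^n : u(y)\ge u(x)+p\cdot(y-x)\ \text{for all }y\in\Omega\}$. Suppose that there are $c>0$ and $\beta>1-\frac2n$ such that $\varphi(x)\le c|x|^{1+\beta}$ for all $x\in\partial\Omega$ sufficiently close to $0$. Then $u>0$ in $\Omega$. -/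

import Mathlib

open MeasureTheory
open scoped Topology

namespace MongeAmpere

/-- `u` is locally convex in `Ω`: every point of `Ω` is the centre of a ball contained in `Ω`
on which `u` is convex. -/
def LocallyConvexOn {n : ℕ} (Ω : Set (EuclideanSpace ℝ (Fin n)))
    (u : EuclideanSpace ℝ (Fin n) → ℝ) : Prop :=
  ∀ x ∈ Ω, ∃ r > 0, Metric.ball x r ⊆ Ω ∧ ConvexOn ℝ (Metric.ball x r) u

/-- The set `∂u(x)` of subgradients of `u : Ω → ℝ` at `x` (the normal mapping). -/
def subgradients {n : ℕ} (Ω : Set (EuclideanSpace ℝ (Fin n)))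
    (u : EuclideanSpace ℝ (Fin n) → ℝ) (x : EuclideanSpace ℝ (Fin n)) :
    Set (EuclideanSpace ℝ (Fin n)) :=
  {p | ∀ y ∈ Ω, u x + inner ℝ p (y - x) ≤ u y}

/-- The Monge-Ampère measure of `u : Ω → ℝ`, `E ↦ |∂u(E)|`, where `∂u(E)` is the union of the
`∂u(x)` over `x ∈ E` and `|·|` is Lebesgue measure. -/
noncomputable def mongeAmpereMeasure {n : ℕ} (Ω : Set (EuclideanSpace ℝ (Fin n)))
    (u : EuclideanSpace ℝ (Fin n) → ℝ) (E : Set (EuclideanSpace ℝ (Fin n))) : ENNReal :=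
  volume (⋃ x ∈ E, subgradients Ω u x)

/-- `u` is a generalized (Alexandrov) solution of `det ∇²u ≥ lam` in the convex domain `Ω`:
it is locally convex in `Ω` and its Monge-Ampère measure is at least `lam` times Lebesgue
measure on the Borel subsets of `Ω`. -/
def IsGeneralizedSolutionGE {n : ℕ} (Ω : Set (EuclideanSpace ℝ (Fin n))) (lam : ℝ)
    (u : EuclideanSpace ℝ (Fin n) → ℝ) : Prop :=
  LocallyConvexOn Ω u ∧
    ∀ E ⊆ Ω, MeasurableSet E → ENNReal.ofReal lam * volume E ≤ mongeAmpereMeasure Ω u E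

end MongeAmpere

/-!
If `u x₀ ≤ 0` at some `x₀ ∈ Ω`, then for small `h` the sublevel set `{u ≤ ε}`, where
`ε = o(h ^ (2 - 2 / n))`, contains `x₀` and, by the growth bound, the boundary points at distance
`O(h)` from `0`. Its convex hull contains an ellipsoid around `x₀ / 2` with one axis along `x₀` of
length comparable to `‖x₀‖` and all the others comparable to `h`. At points of the half-size
ellipsoid `x₀ / 2 + T (B₁)`, a subgradient `p` satisfies `⟪p, T z⟫ ≤ ε` for `‖z‖ ≤ 1`, so it lies in
the dual ellipsoid `‖T* p‖ ≤ ε`, and comparing volumes gives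
`lam * (det T) ^ 2 ≤ ε ^ n`. Here `det T ≳ h ^ (n - 1)`, whereas `ε ^ n = o(h ^ (2 * (n - 1)))`.
-/

open Metric Set Filter Asymptotics
open scoped Pointwise RealInnerProductSpace

namespace MongeAmpere

theorem inter_frontier_nonempty_of_isPreconnected {X : Type*} [TopologicalSpace X] {s t : Set X}
    (ht : IsPreconnected t) (hts : (t ∩ s).Nonempty) (hts' : (t ∩ sᶜ).Nonempty) :
    (t ∩ frontier s).Nonempty := by
  by_contra hempty
  have hcompl : t ⊆ (frontier s)ᶜ := fun x hx hxs => hempty ⟨x, hx, hxs⟩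
  rw [compl_frontier_eq_union_interior] at hcompl
  obtain ⟨x, hxt, hxs⟩ := hts
  obtain ⟨y, hyt, hys⟩ := hts'
  have hx : x ∈ interior s :=
    (hcompl hxt).resolve_right fun h => interior_subset h hxs
  have hy : y ∈ interior sᶜ :=
    (hcompl hyt).resolve_left fun h => hys (interior_subset h)
  obtain ⟨z, -, hzs, hzs'⟩ :=
    ht _ _ isOpen_interior isOpen_interior hcompl ⟨x, hxt, hx⟩ ⟨y, hyt, hy⟩
  exact interior_subset hzs' (interior_subset hzs)

theorem norm_le_of_forall_inner_le {E : Type*} [NormedAddCommGroup E] [InnerProductSpace ℝ E]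
    {p : E} {ε : ℝ} (h : ∀ z, ‖z‖ ≤ 1 → ⟪p, z⟫ ≤ ε) : ‖p‖ ≤ ε := by
  rcases eq_or_ne p 0 with rfl | hp
  · simpa using h 0 (by simp)
  have hp' : ‖p‖ ≠ 0 := norm_ne_zero_iff.2 hp
  calc ‖p‖ = ⟪p, ‖p‖⁻¹ • p⟫ := by
        rw [inner_smul_right, real_inner_self_eq_norm_sq]
        field_simp
    _ ≤ ε := h _ (by simp [norm_smul, hp'])

theorem det_adjoint {𝕜 E : Type*} [RCLike 𝕜] [NormedAddCommGroup E] [InnerProductSpace 𝕜 E]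
    [FiniteDimensional 𝕜 E] (T : E →ₗ[𝕜] E) :
    LinearMap.det (LinearMap.adjoint T) = star (LinearMap.det T) := by
  let b := stdOrthonormalBasis 𝕜 E
  rw [← LinearMap.det_toMatrix b.toBasis, LinearMap.toMatrix_adjoint b b,
    Matrix.det_conjTranspose, LinearMap.det_toMatrix]

theorem isLittleO_norm_rpow_norm_rpow {E : Type*} [SeminormedAddCommGroup E] {a b : ℝ}
    (ha : 0 ≤ a) (hab : a < b) : (fun x : E => ‖x‖ ^ b) =o[𝓝 0] fun x => ‖x‖ ^ a := by
  have hlim : Tendsto (fun x : E => ‖x‖ ^ (b - a)) (𝓝 0) (𝓝 0) := by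
    simpa [Real.zero_rpow (sub_pos.2 hab).ne'] using
      (tendsto_norm_zero (E := E)).rpow_const (p := b - a) (Or.inr (sub_pos.2 hab).le)
  have hsplit (x : E) : ‖x‖ ^ b = ‖x‖ ^ (b - a) * ‖x‖ ^ a := by
    rw [← Real.rpow_add' (norm_nonneg x) (by linarith), sub_add_cancel]
  simpa only [hsplit, one_mul] using
    ((isLittleO_one_iff ℝ).2 hlim).mul_isBigO (isBigO_refl (fun x : E => ‖x‖ ^ a) (𝓝 0))

theorem two_sub_two_div_natCast_nonneg (n : ℕ) : 0 ≤ 2 - 2 / (n : ℝ) := by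
  rcases n.eq_zero_or_pos with rfl | hn
  · simp
  · exact sub_nonneg.2 (div_le_self zero_le_two (by exact_mod_cast hn))

theorem rpow_two_sub_two_div_pow {n : ℕ} (hn : n ≠ 0) {h : ℝ} (hh : 0 < h) :
    (h ^ (2 - 2 / (n : ℝ))) ^ n = (h ^ n / h) ^ 2 := by
  have hexponent : (2 - 2 / (n : ℝ)) * n = (n * 2 : ℕ) - (2 : ℕ) := by
    push_cast
    field_simp
  rw [← Real.rpow_mul_natCast hh.le, hexponent, Real.rpow_sub hh, Real.rpow_natCast,
    Real.rpow_natCast, div_pow, pow_mul]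

theorem isLittleO_of_growth {E : Type*} [SeminormedAddCommGroup E] {S : Set E} {v : E → ℝ}
    {n : ℕ} {c β : ℝ} (hv : ∀ x ∈ S, 0 ≤ v x) (hβ : 1 - 2 / (n : ℝ) < β)
    (hgrowth : ∀ᶠ x in 𝓝[S] 0, v x ≤ c * ‖x‖ ^ (1 + β)) :
    v =o[𝓝[S] 0] fun x => ‖x‖ ^ (2 - 2 / (n : ℝ)) := by
  have hbigO : v =O[𝓝[S] 0] fun x => ‖x‖ ^ (1 + β) := by
    refine IsBigO.of_bound c ?_
    filter_upwards [hgrowth, self_mem_nhdsWithin] with x hx hxS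
    rwa [Real.norm_of_nonneg (hv x hxS), Real.norm_of_nonneg (by positivity)]
  exact hbigO.trans_isLittleO ((isLittleO_norm_rpow_norm_rpow
    (two_sub_two_div_natCast_nonneg n) (by linarith)).mono nhdsWithin_le_nhds)

theorem insert_frontier_inter_closedBall_subset_sublevel {E : Type*} [SeminormedAddCommGroup E]
    {Ω : Set E} {u : E → ℝ} {x₀ : E} {η α ρ : ℝ} (hα : 0 ≤ α) (hη : 0 ≤ η) (hρ : 0 ≤ ρ)
    (hx₀ : x₀ ∈ Ω) (hux₀ : u x₀ ≤ 0)
    (hgrowth : ∀ y ∈ frontier Ω, ‖y‖ ≤ ρ → u y ≤ η * ‖y‖ ^ α) :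
    insert x₀ (frontier Ω ∩ closedBall 0 ρ) ⊆ {y ∈ closure Ω | u y ≤ η * ρ ^ α} := by
  rintro y (rfl | ⟨hy_frontier, hy_ball⟩)
  · exact ⟨subset_closure hx₀, hux₀.trans (by positivity)⟩
  · rw [mem_closedBall_zero_iff] at hy_ball
    refine ⟨frontier_subset_closure hy_frontier, (hgrowth y hy_frontier hy_ball).trans ?_⟩
    gcongr

section Geometry

variable {E : Type*} [NormedAddCommGroup E]

theorem exists_add_smul_mem_frontier [NormedSpace ℝ E] {Ω : Set E} (hΩ : Convex ℝ Ω)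
    (h0 : 0 ∈ frontier Ω) {x₀ v : E} {r s : ℝ} (hball : ball x₀ r ⊆ Ω) (hs : 0 < s) (hs1 : s ≤ 1)
    (hv : ‖v‖ < s * r) : ∃ θ : ℝ, |θ| ≤ s ∧ v + θ • x₀ ∈ frontier Ω := by
  have hmem_interior {w : E} (hw : ‖w‖ = ‖v‖) : x₀ + s⁻¹ • w ∈ interior Ω := by
    refine interior_maximal hball isOpen_ball ?_
    rwa [mem_ball_iff_norm, add_sub_cancel_left, norm_smul, norm_inv, Real.norm_of_nonneg hs.le,
      inv_mul_lt_iff₀ hs, hw]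
  have hinside : v + s • x₀ ∈ Ω := by
    have h := hΩ.combo_interior_closure_mem_interior (hmem_interior rfl) h0.1 hs
      (sub_nonneg.2 hs1) (add_sub_cancel s 1)
    rw [smul_zero, add_zero, smul_add, smul_inv_smul₀ hs.ne', add_comm] at h
    exact interior_subset h
  -- Otherwise `0` would lie between this point and the interior point `x₀ - s⁻¹ • v`.
  have houtside : v + (-s) • x₀ ∉ Ω := by
    intro h
    have h' := hΩ.combo_interior_self_mem_interior (hmem_interior (norm_neg v)) h
      (a := s / (1 + s)) (b := 1 / (1 + s)) (by positivity) (by positivity) (by field_simp; ring)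
    refine h0.2 ?_
    convert h' using 1
    match_scalars <;> field_simp <;> ring
  have hpre : IsPreconnected ((fun θ : ℝ => v + θ • x₀) '' Icc (-s) s) :=
    isPreconnected_Icc.image _ (by fun_prop)
  obtain ⟨_, ⟨θ, hθ, rfl⟩, hfront⟩ := inter_frontier_nonempty_of_isPreconnected hpre
    ⟨_, mem_image_of_mem _ ⟨by linarith, le_rfl⟩, hinside⟩
    ⟨_, mem_image_of_mem _ ⟨le_rfl, by linarith⟩, houtside⟩
  exact ⟨θ, abs_le.2 hθ, hfront⟩

theorem subset_of_subset_closure_of_convex [NormedSpace ℝ E] {Ω V : Set E} (hΩ_open : IsOpen Ω)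
    (hΩ_conv : Convex ℝ Ω) (hV : IsOpen V) (hVΩ : V ⊆ closure Ω) : V ⊆ Ω := by
  rcases Ω.eq_empty_or_nonempty with rfl | hΩ
  · rwa [closure_empty] at hVΩ
  rw [← hΩ_open.interior_eq] at hΩ
  simpa only [hΩ_conv.interior_closure_eq_interior_of_nonempty_interior hΩ, hΩ_open.interior_eq]
    using interior_maximal hVΩ hV

theorem add_smul_mem_of_convex {V : Type*} [AddCommGroup V] [Module ℝ V] {K : Set V}
    (hK : Convex ℝ K) {x₀ w : V} {θ₁ θ₂ t : ℝ} (hx₀ : x₀ ∈ K) (h₁ : w + θ₁ • x₀ ∈ K)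
    (h₂ : (5 : ℝ) • w + θ₂ • x₀ ∈ K) (hθ₁ : θ₁ ≤ 1 / 4) (hθ₂ : -(1 / 4) ≤ θ₂)
    (ht : t ∈ Icc (1 / 4) (3 / 4)) : w + t • x₀ ∈ K := by
  have hfar : w + (4 / 5 + θ₂ / 5) • x₀ ∈ K := by
    convert hK h₂ hx₀ (a := 1 / 5) (b := 4 / 5) (by norm_num) (by norm_num) (by norm_num) using 1
    module
  have hline : Convex ℝ {θ : ℝ | w + θ • x₀ ∈ K} :=
    (hK.translate_preimage_right w).linear_preimage (LinearMap.toSpanSingleton ℝ V x₀)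
  exact hline.ordConnected.out h₁ hfar ⟨hθ₁.trans ht.1, by linarith [ht.2]⟩

variable [InnerProductSpace ℝ E]

/-- The linear map `z ↦ h z + (⟪x₀, z⟫ / (8 ‖x₀‖)) x₀`. For small `h > 0` it maps the unit ball onto
an ellipsoid whose axis along `x₀` is comparable to `‖x₀‖` and whose other axes have half-length
`h`. -/
noncomputable def ellipsoidMap (x₀ : E) (h : ℝ) : E →ₗ[ℝ] E :=
  h • LinearMap.id + ((8 * ‖x₀‖)⁻¹ • innerₗ E x₀).smulRight x₀

theorem ellipsoidMap_apply (x₀ z : E) (h : ℝ) :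
    ellipsoidMap x₀ h z = h • z + ((8 * ‖x₀‖)⁻¹ * ⟪x₀, z⟫) • x₀ := rfl

theorem det_ellipsoidMap [FiniteDimensional ℝ E] (x₀ : E) {h : ℝ} (hh : h ≠ 0) :
    LinearMap.det (ellipsoidMap x₀ h) = h ^ Module.finrank ℝ E * (1 + ‖x₀‖ / 8 / h) := by
  have hsmul : ellipsoidMap x₀ h =
      h • LinearMap.transvection ((8 * h * ‖x₀‖)⁻¹ • innerₗ E x₀) x₀ := by
    ext z
    simp only [ellipsoidMap_apply, LinearMap.smul_apply, LinearMap.transvection.apply,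
      innerₗ_apply_apply, smul_eq_mul]
    match_scalars <;> field_simp
  rw [hsmul, LinearMap.det_smul, LinearMap.transvection.det, LinearMap.smul_apply,
    innerₗ_apply_apply, real_inner_self_eq_norm_sq, smul_eq_mul]
  congr 2
  rcases eq_or_ne x₀ 0 with rfl | hx₀
  · simp
  have := norm_ne_zero_iff.2 hx₀
  field_simp

theorem abs_inv_norm_mul_inner_le {x₀ z : E} (hz : ‖z‖ ≤ 2) :
    |(8 * ‖x₀‖)⁻¹ * ⟪x₀, z⟫| ≤ 1 / 4 := by
  rcases eq_or_ne x₀ 0 with rfl | hx₀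
  · simp
  have hpos : 0 < ‖x₀‖ := norm_pos_iff.2 hx₀
  rw [abs_mul, abs_of_pos (by positivity), inv_mul_le_iff₀ (by positivity)]
  nlinarith [abs_real_inner_le_norm x₀ z]

theorem exists_ellipsoid_subset_convexHull {Ω : Set E} (hΩ : Convex ℝ Ω) (h0 : 0 ∈ frontier Ω)
    {x₀ : E} (hx₀ : x₀ ∈ interior Ω) :
    ∃ C > 0, ∀ᶠ h in 𝓝[>] (0 : ℝ), ∀ z : E, ‖z‖ ≤ 2 →
      (1 / 2 : ℝ) • x₀ + ellipsoidMap x₀ h z ∈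
        convexHull ℝ (insert x₀ (frontier Ω ∩ closedBall 0 (C * h))) := by
  obtain ⟨r, hr, hball⟩ := Metric.mem_nhds_iff.1 (mem_interior_iff_mem_nhds.1 hx₀)
  refine ⟨10 + 12 / r * ‖x₀‖, by positivity, ?_⟩
  have hsmall : ∀ᶠ h in 𝓝[>] (0 : ℝ), h < r / 48 :=
    eventually_nhdsWithin_of_eventually_nhds (eventually_lt_nhds (by positivity))
  filter_upwards [hsmall, self_mem_nhdsWithin] with h hhr (hh : 0 < h) z hz
  set K := insert x₀ (frontier Ω ∩ closedBall 0 ((10 + 12 / r * ‖x₀‖) * h))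
  have hs : 12 * h / r ≤ 1 / 4 := by
    rw [div_le_iff₀ hr]
    linarith
  have hboundary (v : E) (hv : ‖v‖ ≤ 10 * h) :
      ∃ θ : ℝ, |θ| ≤ 1 / 4 ∧ v + θ • x₀ ∈ convexHull ℝ K := by
    obtain ⟨θ, hθ, hfront⟩ := exists_add_smul_mem_frontier hΩ h0 (v := v) hball
      (s := 12 * h / r) (by positivity) (by linarith)
      (by rw [div_mul_cancel₀ _ hr.ne']; linarith)
    have hnorm : ‖v + θ • x₀‖ ≤ (10 + 12 / r * ‖x₀‖) * h :=
      calc ‖v + θ • x₀‖ ≤ ‖v‖ + |θ| * ‖x₀‖ := by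
            simpa [norm_smul] using norm_add_le v (θ • x₀)
        _ ≤ 10 * h + 12 * h / r * ‖x₀‖ := by gcongr
        _ = (10 + 12 / r * ‖x₀‖) * h := by ring
    exact ⟨θ, hθ.trans hs,
      subset_convexHull ℝ K (Or.inr ⟨hfront, mem_closedBall_zero_iff.2 hnorm⟩)⟩
  have hw : ‖h • z‖ ≤ 2 * h := by
    rw [norm_smul, Real.norm_of_nonneg hh.le]
    nlinarith
  obtain ⟨θ₁, hθ₁, h₁⟩ := hboundary (h • z) (by linarith)
  obtain ⟨θ₂, hθ₂, h₂⟩ := hboundary ((5 : ℝ) • h • z) (by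
    rw [norm_smul, Real.norm_of_nonneg (by norm_num)]
    linarith)
  have hcoeff := abs_le.1 (abs_inv_norm_mul_inner_le (x₀ := x₀) hz)
  convert add_smul_mem_of_convex (convex_convexHull ℝ K) (subset_convexHull ℝ K (mem_insert x₀ _))
    h₁ h₂ (abs_le.1 hθ₁).2 (abs_le.1 hθ₂).1 (t := 1 / 2 + (8 * ‖x₀‖)⁻¹ * ⟪x₀, z⟫)
    ⟨by linarith, by linarith⟩ using 1
  rw [ellipsoidMap_apply]
  module

end Geometry

section Subgradients

variable {n : ℕ} {Ω : Set (EuclideanSpace ℝ (Fin n))} {u : EuclideanSpace ℝ (Fin n) → ℝ}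

theorem add_inner_le_of_mem_convexHull (hu_cont : ContinuousOn u (closure Ω))
    {x p y : EuclideanSpace ℝ (Fin n)} (hp : p ∈ subgradients Ω u x) {ε : ℝ}
    (hy : y ∈ convexHull ℝ {y ∈ closure Ω | u y ≤ ε}) : u x + ⟪p, y - x⟫ ≤ ε := by
  have hclosure : ∀ y ∈ closure Ω, u x + ⟪p, y - x⟫ ≤ u y := fun y hy =>
    le_on_closure (f := fun y => u x + ⟪p, y - x⟫) hp (by fun_prop) hu_cont hy
  have hhalfSpace : y ∈ {y | innerₗ _ p y ≤ ε - u x + ⟪p, x⟫} := by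
    refine convexHull_min (fun y hy => ?_) (convex_halfSpace_le (innerₗ _ p).isLinear _) hy
    have h := (hclosure y hy.1).trans hy.2
    rw [inner_sub_right] at h
    change ⟪p, y⟫ ≤ _
    linarith
  rw [mem_ofPred_eq, innerₗ_apply_apply] at hhalfSpace
  rw [inner_sub_right]
  linarith

theorem norm_adjoint_le_of_mem_subgradients (hu_cont : ContinuousOn u (closure Ω)) {ε : ℝ}
    {T : EuclideanSpace ℝ (Fin n) →ₗ[ℝ] EuclideanSpace ℝ (Fin n)}
    {x p : EuclideanSpace ℝ (Fin n)} (hux : 0 ≤ u x) (hp : p ∈ subgradients Ω u x)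
    (hT : ∀ z, ‖z‖ ≤ 1 → x + T z ∈ convexHull ℝ {y ∈ closure Ω | u y ≤ ε}) :
    ‖LinearMap.adjoint T p‖ ≤ ε := by
  refine norm_le_of_forall_inner_le fun z hz => ?_
  have h := add_inner_le_of_mem_convexHull hu_cont hp (hT z hz)
  rw [add_sub_cancel_left] at h
  rw [LinearMap.adjoint_inner_left]
  linarith

theorem mul_det_sq_le_of_ellipsoid_subset (hΩ_open : IsOpen Ω) (hΩ_conv : Convex ℝ Ω)
    (hu_cont : ContinuousOn u (closure Ω)) (hu_nonneg : ∀ x ∈ Ω, 0 ≤ u x) {lam : ℝ}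
    (hlam : 0 ≤ lam)
    (hMA : ∀ E ⊆ Ω, MeasurableSet E → ENNReal.ofReal lam * volume E ≤ mongeAmpereMeasure Ω u E)
    {ε : ℝ} (hε : 0 ≤ ε) {T : EuclideanSpace ℝ (Fin n) →ₗ[ℝ] EuclideanSpace ℝ (Fin n)}
    {x : EuclideanSpace ℝ (Fin n)}
    (hT : ∀ z, ‖z‖ ≤ 2 → x + T z ∈ convexHull ℝ {y ∈ closure Ω | u y ≤ ε}) :
    lam * LinearMap.det T ^ 2 ≤ ε ^ n := by
  rcases eq_or_ne (LinearMap.det T) 0 with hdet | hdet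
  · rw [hdet, sq, mul_zero, mul_zero]
    positivity
  set V := x +ᵥ T '' ball 0 1 with hV
  have hV_open : IsOpen V :=
    (T.isOpenMap_of_finiteDimensional
      (LinearMap.equivOfDetNeZero T hdet).surjective _ isOpen_ball).vadd x
  have hVΩ : V ⊆ Ω := by
    refine subset_of_subset_closure_of_convex hΩ_open hΩ_conv hV_open ?_
    rintro _ ⟨_, ⟨z, hz, rfl⟩, rfl⟩
    exact convexHull_min (fun y hy => hy.1) hΩ_conv.closure
      (hT z (by linarith [mem_ball_zero_iff.1 hz]))
  have hsubgradients : ⋃ y ∈ V, subgradients Ω u y ⊆ LinearMap.adjoint T ⁻¹' closedBall 0 ε := by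
    refine iUnion₂_subset fun y hy p hp => mem_closedBall_zero_iff.2 ?_
    have huy := hu_nonneg y (hVΩ hy)
    obtain ⟨_, ⟨z₀, hz₀, rfl⟩, rfl⟩ := hy
    refine norm_adjoint_le_of_mem_subgradients hu_cont huy hp fun z hz => ?_
    have hz₀' := mem_ball_zero_iff.1 hz₀
    simpa [add_assoc] using hT (z₀ + z) ((norm_add_le _ _).trans (by linarith))
  have hdet' : LinearMap.det (LinearMap.adjoint T) ≠ 0 := by
    simpa only [det_adjoint, star_trivial] using hdet
  have hvolume := (hMA V hVΩ hV_open.measurableSet).trans (measure_mono hsubgradients)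
  rw [hV, measure_vadd, Measure.addHaar_image_linearMap,
    Measure.addHaar_preimage_linearMap volume hdet', Measure.addHaar_closedBall volume 0 hε,
    det_adjoint, star_trivial, finrank_euclideanSpace_fin, ← mul_assoc, ← mul_assoc,
    ENNReal.mul_le_mul_iff_left (measure_ball_pos volume 0 one_pos).ne' measure_ball_lt_top.ne,
    ← ENNReal.ofReal_mul hlam, ← ENNReal.ofReal_mul (abs_nonneg _),
    ENNReal.ofReal_le_ofReal_iff (by positivity), abs_inv, inv_mul_eq_div,
    le_div_iff₀ (abs_pos.2 hdet)] at hvolume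
  rwa [← sq_abs, sq, ← mul_assoc]

theorem mul_sq_le_of_ellipsoidMap_subset (hΩ_open : IsOpen Ω) (hΩ_conv : Convex ℝ Ω)
    (hu_cont : ContinuousOn u (closure Ω)) (hu_nonneg : ∀ x ∈ Ω, 0 ≤ u x) {lam : ℝ}
    (hlam : 0 ≤ lam)
    (hMA : ∀ E ⊆ Ω, MeasurableSet E → ENNReal.ofReal lam * volume E ≤ mongeAmpereMeasure Ω u E)
    {ε h : ℝ} (hε : 0 ≤ ε) (hh : 0 < h) {x x₀ : EuclideanSpace ℝ (Fin n)}
    (hsub : ∀ z, ‖z‖ ≤ 2 →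
      x + ellipsoidMap x₀ h z ∈ convexHull ℝ {y ∈ closure Ω | u y ≤ ε}) :
    lam * (‖x₀‖ / 8) ^ 2 * (h ^ n / h) ^ 2 ≤ ε ^ n :=
  calc lam * (‖x₀‖ / 8) ^ 2 * (h ^ n / h) ^ 2 = lam * (h ^ n * (‖x₀‖ / 8 / h)) ^ 2 := by ring
    _ ≤ lam * (h ^ n * (1 + ‖x₀‖ / 8 / h)) ^ 2 := by gcongr; linarith
    _ = lam * LinearMap.det (ellipsoidMap x₀ h) ^ 2 := by
      rw [det_ellipsoidMap x₀ hh.ne', finrank_euclideanSpace_fin]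
    _ ≤ ε ^ n :=
      mul_det_sq_le_of_ellipsoid_subset hΩ_open hΩ_conv hu_cont hu_nonneg hlam hMA hε hsub

theorem exists_le_mul_pow_of_boundary_growth (hΩ_open : IsOpen Ω) (hΩ_conv : Convex ℝ Ω)
    (h0 : 0 ∈ frontier Ω) (hu_cont : ContinuousOn u (closure Ω)) (hu_nonneg : ∀ x ∈ Ω, 0 ≤ u x)
    {lam : ℝ} (hlam : 0 ≤ lam)
    (hMA : ∀ E ⊆ Ω, MeasurableSet E → ENNReal.ofReal lam * volume E ≤ mongeAmpereMeasure Ω u E)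
    {x₀ : EuclideanSpace ℝ (Fin n)} (hx₀ : x₀ ∈ Ω) (hux₀ : u x₀ ≤ 0) :
    ∃ M : ℝ, ∀ η > 0, (∀ᶠ x in 𝓝[frontier Ω] 0, u x ≤ η * ‖x‖ ^ (2 - 2 / (n : ℝ))) →
      lam ≤ M * η ^ n := by
  have hx₀_ne : x₀ ≠ 0 := by
    rintro rfl
    exact h0.2 (by rwa [hΩ_open.interior_eq])
  have hn : n ≠ 0 := by
    rintro rfl
    exact hx₀_ne (Subsingleton.elim _ _)
  obtain ⟨C, hC, hellipsoid⟩ :=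
    exists_ellipsoid_subset_convexHull hΩ_conv h0 (hΩ_open.interior_eq.symm ▸ hx₀)
  refine ⟨(C ^ (2 - 2 / (n : ℝ))) ^ n / (‖x₀‖ / 8) ^ 2, fun η hη hgrowth => ?_⟩
  have hscale : Tendsto (fun h => C * h) (𝓝[>] 0) (𝓝 0) :=
    ((continuous_const_mul C).tendsto' 0 0 (mul_zero C)).mono_left nhdsWithin_le_nhds
  obtain ⟨h, hellipsoid, hgrowth, hh : 0 < h⟩ := (hellipsoid.and ((hscale.eventually
    (eventually_closedBall_subset (eventually_nhdsWithin_iff.1 hgrowth))).and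
      self_mem_nhdsWithin)).exists
  have hsublevel := insert_frontier_inter_closedBall_subset_sublevel
    (two_sub_two_div_natCast_nonneg n) hη.le (mul_nonneg hC.le hh.le) hx₀ hux₀
    fun y hy hy_ball => hgrowth (mem_closedBall_zero_iff.2 hy_ball) hy
  have hvolume := mul_sq_le_of_ellipsoidMap_subset hΩ_open hΩ_conv hu_cont hu_nonneg hlam hMA
    (by positivity) hh fun z hz => convexHull_mono hsublevel (hellipsoid z hz)
  have hpow : (η * (C * h) ^ (2 - 2 / (n : ℝ))) ^ n =
      (C ^ (2 - 2 / (n : ℝ))) ^ n * η ^ n * (h ^ n / h) ^ 2 := by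
    rw [Real.mul_rpow hC.le hh.le, mul_pow, mul_pow, rpow_two_sub_two_div_pow hn hh]
    ring
  rw [hpow] at hvolume
  rw [div_mul_eq_mul_div, le_div_iff₀ (by positivity)]
  exact le_of_mul_le_mul_right hvolume (by positivity)

end Subgradients

end MongeAmpere

theorem lemma3p1_general {n : ℕ} {Ω : Set (EuclideanSpace ℝ (Fin n))} (hΩ_open : IsOpen Ω)
    (hΩ_conv : Convex ℝ Ω) (h0 : 0 ∈ frontier Ω) {u : EuclideanSpace ℝ (Fin n) → ℝ}
    (hu_cont : ContinuousOn u (closure Ω)) (hu_nonneg : ∀ x ∈ Ω, 0 ≤ u x)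
    {lam : ℝ} (hlam : 0 < lam)
    (hMA : ∀ E ⊆ Ω, MeasurableSet E →
      ENNReal.ofReal lam * volume E ≤ MongeAmpere.mongeAmpereMeasure Ω u E)
    (hgrowth : u =o[𝓝[frontier Ω] 0] fun x => ‖x‖ ^ (2 - 2 / (n : ℝ))) :
    ∀ x ∈ Ω, 0 < u x := by
  intro x₀ hx₀
  by_contra! hux₀
  have hn : n ≠ 0 := by
    rintro rfl
    exact h0.2 (by rwa [hΩ_open.interior_eq, Subsingleton.elim 0 x₀])
  obtain ⟨M, hM⟩ := MongeAmpere.exists_le_mul_pow_of_boundary_growth hΩ_open hΩ_conv h0 hu_cont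
    hu_nonneg hlam.le hMA hx₀ hux₀
  have hbound : ∀ η > 0, lam ≤ M * η ^ n := fun η hη => hM η hη <|
    (hgrowth.bound hη).mono fun x hx => by
      rw [Real.norm_of_nonneg (by positivity : 0 ≤ ‖x‖ ^ (2 - 2 / (n : ℝ)))] at hx
      exact (le_abs_self _).trans hx
  have hlim : Tendsto (fun η : ℝ => M * η ^ n) (𝓝[>] 0) (𝓝 0) :=
    (Continuous.tendsto' (by fun_prop) 0 0 (by simp [hn])).mono_left nhdsWithin_le_nhds
  exact hlam.not_ge (ge_of_tendsto hlim (eventually_mem_nhdsWithin.mono hbound))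

theorem lemma3p1 {n : ℕ} (Ω : Set (EuclideanSpace ℝ (Fin n)))
    (hΩ_open : IsOpen Ω) (hΩ_bdd : Bornology.IsBounded Ω) (hΩ_conv : Convex ℝ Ω)
    (h0 : (0 : EuclideanSpace ℝ (Fin n)) ∈ frontier Ω)
    (lam : ℝ) (hlam : 0 < lam)
    (φ : EuclideanSpace ℝ (Fin n) → ℝ) (hφ_cont : ContinuousOn φ (frontier Ω))
    (hφ_nonneg : ∀ x ∈ frontier Ω, 0 ≤ φ x)
    (u : EuclideanSpace ℝ (Fin n) → ℝ) (hu_cont : ContinuousOn u (closure Ω))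
    (hu_nonneg : ∀ x ∈ Ω, 0 ≤ u x)
    (hu_sol : MongeAmpere.IsGeneralizedSolutionGE Ω lam u)
    (hu_bdry : ∀ x ∈ frontier Ω, u x = φ x)
    (c β : ℝ) (hc : 0 < c) (hβ : 1 - 2 / (n : ℝ) < β)
    (hφ_growth : ∀ᶠ x in 𝓝[frontier Ω] 0, φ x ≤ c * ‖x‖ ^ (1 + β)) :
    ∀ x ∈ Ω, 0 < u x := by
  have hu_frontier : ∀ x ∈ frontier Ω, 0 ≤ u x := fun x hx => hu_bdry x hx ▸ hφ_nonneg x hx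
  have hu_growth : ∀ᶠ x in 𝓝[frontier Ω] 0, u x ≤ c * ‖x‖ ^ (1 + β) := by
    filter_upwards [hφ_growth, self_mem_nhdsWithin] with x hx hx_frontier
    rwa [hu_bdry x hx_frontier]
  exact lemma3p1_general hΩ_open hΩ_conv h0 hu_cont hu_nonneg hlam hu_sol.2
    (MongeAmpere.isLittleO_of_growth hu_frontier hβ hu_growth)
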